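/- For $d\ge 0$ let $\gamma_d$ be the standard Gaussian measure on $\mathbb{R}^d$. There is a constant $C>0$, independent of $d$, such that for every $d$ and every real-valued function $f\in L^2(\gamma_d)$ whose weak (distributional) gradient $\nabla f$ exists on $\mathbb{R}^d$ and satisfies $|\nabla f|\in L^2(\gamma_d)$, the function $f^2\log\bigl(f^2/\int f^2\,d\gamma_d\bigr)$ is $\gamma_d$-integrable and $$\int f^2\log\Bigl(\frac{f^2}{\int f^2\,d\gamma_d}\Bigr)\,d\gamma_d\;\le\; C\int|\nabla f|^2\,d\gamma_d ,$$ where $|\cdot|$ is the Euclidean norm and the left-hand integrand is read as $0$ wherever $f=0$ (in particular everywhere if $f=0$). -/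

import Mathlib

open MeasureTheory ProbabilityTheory
open scoped ContDiff

/-- `HasWeakGradient f g`: the vector field `g` is the weak (distributional) gradient of `f` on
`ℝ^d`, i.e. both are locally Lebesgue integrable and, for every smooth compactly supported
function `φ` and every direction `v`, `∫ f ∂ᵥφ dx = - ∫ φ ⟨g, v⟩ dx`. -/
def HasWeakGradient {d : ℕ} (f : EuclideanSpace ℝ (Fin d) → ℝ)
    (g : EuclideanSpace ℝ (Fin d) → EuclideanSpace ℝ (Fin d)) : Prop :=
  LocallyIntegrable f volume ∧ LocallyIntegrable g volume ∧
    ∀ φ : EuclideanSpace ℝ (Fin d) → ℝ, ContDiff ℝ ∞ φ → HasCompactSupport φ →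
      ∀ v : EuclideanSpace ℝ (Fin d),
        ∫ x, f x * fderiv ℝ φ x v = - ∫ x, φ x * inner ℝ (g x) v

/-!
Convolution with the Gaussian of covariance `t` is the heat semigroup `P_t`, whose kernel at time
one issued from the origin is `γ_d`. Let `Ent_t F x` be the entropy of a density `F` under the heat
kernel issued from `x`. The heat kernels form a convolution semigroup, so entropy obeys the chain
rule `Ent_{s+t} F = P_t (Ent_s F) + Ent_t (P_s F)`. A Taylor expansion at small times gives
`Ent_t F ≤ (t / 2) |∇F|² / F + O(t^{3/2})`, with an error controlled by bounds on `F` and on its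
first two derivatives. The semigroup preserves these bounds, and it decreases the Fisher
information: `|∇P_t F|² / P_t F ≤ P_t (|∇F|² / F)` by the Cauchy–Schwarz inequality. Cutting the
unit of time into `m` equal steps, the errors add up to `O(m^{-1/2})`, and `m → ∞` leaves
`Ent_γ F ≤ (1 / 2) ∫ |∇F|² / F dγ`. For `F = f² + ε` the right-hand side is at most
`2 ∫ |∇f|² dγ`. A function with a weak gradient is approximated by cutoff and mollification; since
`t log t` is bounded below, Fatou's lemma passes the inequality to the limit.
-/

open Filter InformationTheory Real Topology
open scoped RealInnerProductSpace

section Integrals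

variable {Ω : Type*} [MeasurableSpace Ω] {μ : Measure Ω}

lemma norm_integral_smul_sq_le {G : Type*} [NormedAddCommGroup G] [NormedSpace ℝ G] {w : Ω → ℝ}
    {v : Ω → G} (hw₀ : ∀ x, 0 ≤ w x) (hw : Integrable w μ) (hwv : Integrable (fun x ↦ w x • v x) μ)
    (hwv₂ : Integrable (fun x ↦ w x * ‖v x‖ ^ 2) μ) :
    ‖∫ x, w x • v x ∂μ‖ ^ 2 ≤ (∫ x, w x ∂μ) * ∫ x, w x * ‖v x‖ ^ 2 ∂μ := by
  have hwv₁ : Integrable (fun x ↦ w x * ‖v x‖) μ := by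
    simpa only [norm_smul, norm_of_nonneg (hw₀ _)] using hwv.norm
  have hnorm : ‖∫ x, w x • v x ∂μ‖ ≤ ∫ x, w x * ‖v x‖ ∂μ := by
    simpa only [norm_smul, norm_of_nonneg (hw₀ _)] using
      norm_integral_le_integral_norm (μ := μ) fun x ↦ w x • v x
  have hquad (r : ℝ) : 0 ≤ (∫ x, w x ∂μ) * (r * r) + (2 * ∫ x, w x * ‖v x‖ ∂μ) * r
      + ∫ x, w x * ‖v x‖ ^ 2 ∂μ := by
    have hsq : 0 ≤ ∫ x, (w x * (r * r) + w x * ‖v x‖ * (2 * r) + w x * ‖v x‖ ^ 2) ∂μ :=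
      integral_nonneg fun x ↦ by
        have := mul_nonneg (hw₀ x) (sq_nonneg (r + ‖v x‖))
        simp only [Pi.zero_apply]
        linarith
    rw [integral_add ((hw.mul_const _).fun_add (hwv₁.mul_const _)) hwv₂,
      integral_add (hw.mul_const _) (hwv₁.mul_const _), integral_mul_const,
      integral_mul_const] at hsq
    linarith
  have hdiscrim := discrim_le_zero hquad
  rw [discrim] at hdiscrim
  have := pow_le_pow_left₀ (norm_nonneg _) hnorm 2
  linarith

lemma integrable_and_integral_le_of_tendsto {u : ℕ → Ω → ℝ} {v : Ω → ℝ} {B : ℕ → ℝ} {B₀ : ℝ}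
    (hu : ∀ n, Integrable (u n) μ) (hu₀ : ∀ n x, 0 ≤ u n x)
    (huv : ∀ᵐ x ∂μ, Tendsto (u · x) atTop (𝓝 (v x))) (hle : ∀ n, ∫ x, u n x ∂μ ≤ B n)
    (hB : Tendsto B atTop (𝓝 B₀)) : Integrable v μ ∧ ∫ x, v x ∂μ ≤ B₀ := by
  have hv₀ : 0 ≤ᵐ[μ] v := huv.mono fun x hx ↦ ge_of_tendsto' hx fun n ↦ hu₀ n x
  have hv : AEStronglyMeasurable v μ := aestronglyMeasurable_of_tendsto_ae atTop (hu · |>.1) huv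
  have hB₀ : 0 ≤ B₀ := ge_of_tendsto' hB fun n ↦ (integral_nonneg (hu₀ n)).trans (hle n)
  have fatou : ∫⁻ x, ENNReal.ofReal (v x) ∂μ ≤ ENNReal.ofReal B₀ := by
    calc ∫⁻ x, ENNReal.ofReal (v x) ∂μ
        = ∫⁻ x, liminf (fun n ↦ ENNReal.ofReal (u n x)) atTop ∂μ :=
          lintegral_congr_ae <| huv.mono fun x hx ↦ (ENNReal.tendsto_ofReal hx).liminf_eq.symm
      _ ≤ liminf (fun n ↦ ∫⁻ x, ENNReal.ofReal (u n x) ∂μ) atTop :=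
          lintegral_liminf_le' fun n ↦ (hu n).aemeasurable.ennreal_ofReal
      _ ≤ liminf (fun n ↦ ENNReal.ofReal (B n)) atTop := by
          refine liminf_le_liminf (Eventually.of_forall fun n ↦ ?_)
          rw [← ofReal_integral_eq_lintegral_ofReal (hu n) (ae_of_all _ (hu₀ n))]
          exact ENNReal.ofReal_le_ofReal (hle n)
      _ = ENNReal.ofReal B₀ := (ENNReal.tendsto_ofReal hB).liminf_eq
  have hvi : Integrable v μ :=
    ⟨hv, (hasFiniteIntegral_iff_ofReal hv₀).2 (fatou.trans_lt ENNReal.ofReal_lt_top)⟩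
  refine ⟨hvi, ?_⟩
  rwa [← ofReal_integral_eq_lintegral_ofReal hvi hv₀, ENNReal.ofReal_le_ofReal_iff hB₀] at fatou

lemma tendsto_integral_of_le_of_tendsto {u : ℕ → Ω → ℝ} {v : Ω → ℝ} {B : ℕ → ℝ}
    (hu : ∀ n, Integrable (u n) μ) (hu₀ : ∀ n x, 0 ≤ u n x)
    (huv : ∀ᵐ x ∂μ, Tendsto (u · x) atTop (𝓝 (v x))) (hle : ∀ n, ∫ x, u n x ∂μ ≤ B n)
    (hB : Tendsto B atTop (𝓝 (∫ x, v x ∂μ))) :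
    Tendsto (fun n ↦ ∫ x, u n x ∂μ) atTop (𝓝 (∫ x, v x ∂μ)) := by
  refine tendsto_order.2 ⟨fun a ha ↦ ?_, fun a ha ↦ ?_⟩
  · by_contra hcon
    obtain ⟨φ, hφ, hφa⟩ := extraction_of_frequently_atTop (not_eventually.1 hcon)
    exact ha.not_ge (integrable_and_integral_le_of_tendsto (fun n ↦ hu (φ n)) (fun n ↦ hu₀ (φ n))
      (huv.mono fun x hx ↦ hx.comp hφ.tendsto_atTop) (fun n ↦ not_lt.1 (hφa n))
      tendsto_const_nhds).2
  · exact (hB.eventually_lt_const ha).mono fun n hn ↦ (hle n).trans_lt hn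

lemma tendsto_integral_norm_sq_of_dominated {G : Type*} [NormedAddCommGroup G] {u : ℕ → Ω → G}
    {v : Ω → G} {b : Ω → ℝ} (hu : ∀ n, AEStronglyMeasurable (u n) μ) (hb : MemLp b 2 μ)
    (hle : ∀ n, ∀ᵐ x ∂μ, ‖u n x‖ ≤ b x) (huv : ∀ᵐ x ∂μ, Tendsto (u · x) atTop (𝓝 (v x))) :
    Tendsto (fun n ↦ ∫ x, ‖u n x‖ ^ 2 ∂μ) atTop (𝓝 (∫ x, ‖v x‖ ^ 2 ∂μ)) := by
  refine tendsto_integral_of_dominated_convergence (fun x ↦ b x ^ 2)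
    (fun n ↦ ((hu n).norm.pow 2)) hb.integrable_sq (fun n ↦ (hle n).mono fun x hx ↦ ?_)
    (huv.mono fun x hx ↦ hx.norm.pow 2)
  rw [norm_pow, norm_norm]
  gcongr

end Integrals

section Entropy

lemma klFun_le {x : ℝ} (hx : 0 ≤ x) : klFun x ≤ (x - 1) ^ 2 / 2 + |x - 1| ^ 3 / 2 := by
  rcases hx.eq_or_lt with rfl | hx
  · norm_num [klFun_zero]
  rw [klFun_apply]
  rcases le_total 1 x with h1 | h1
  · have hlog : log x ≤ (x - x⁻¹) / 2 := sinh_log hx ▸ self_le_sinh_iff.2 (log_nonneg h1)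
    have hmul : x * log x ≤ x * ((x - x⁻¹) / 2) := by gcongr
    have hinv : x * x⁻¹ = 1 := mul_inv_cancel₀ hx.ne'
    have hcube : 0 ≤ |x - 1| ^ 3 := by positivity
    linarith
  · have hlog : 2 * (1 / x - 1) / (1 / x - 1 + 2) ≤ -log x := by
      simpa using le_log_one_add_of_nonneg (sub_nonneg.2 (one_le_one_div hx h1))
    have hmul := mul_le_mul_of_nonneg_left hlog hx.le
    have hfrac : x * (2 * (1 / x - 1) / (1 / x - 1 + 2))
        = 1 - x - (1 - x) ^ 2 / (1 + x) := by
      field_simp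
      ring
    have hgap : (1 - x) ^ 2 / (1 + x) ≤ (1 - x) ^ 2 / 2 + (1 - x) ^ 3 / 2 := by
      rw [div_le_iff₀ (by positivity)]
      have := mul_nonneg (mul_nonneg (pow_nonneg (sub_nonneg.2 h1) 3) hx.le) zero_le_two
      nlinarith [pow_nonneg (sub_nonneg.2 h1) 3]
    rw [abs_of_nonpos (sub_nonpos.2 h1)]
    linarith

lemma mul_klFun_div {c : ℝ} (hc : c ≠ 0) (x : ℝ) :
    c * klFun (x / c) = x * log x - x * log c + c - x := by
  rcases eq_or_ne x 0 with rfl | hx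
  · simp [klFun_zero]
  · rw [klFun_apply, log_div hx hc]
    field_simp

variable {Ω : Type*} [MeasurableSpace Ω] {μ : Measure Ω} {G : Ω → ℝ}

/-- The entropy `∫ G log G - (∫ G) log (∫ G)` of a density `G`, which is not required to be
normalised. -/
noncomputable def entropy (μ : Measure Ω) (G : Ω → ℝ) : ℝ :=
  ∫ x, G x * log (G x) ∂μ - (∫ x, G x ∂μ) * log (∫ x, G x ∂μ)

lemma integral_mul_klFun_div [IsProbabilityMeasure μ] (hG : Integrable G μ)
    (hlog : Integrable (fun x ↦ G x * log (G x)) μ) {c : ℝ} (hc : c ≠ 0) :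
    ∫ x, c * klFun (G x / c) ∂μ = entropy μ G + c * klFun ((∫ x, G x ∂μ) / c) := by
  have hdiff : Integrable (fun x ↦ G x * log (G x) - G x * log c) μ := hlog.sub (hG.mul_const _)
  simp only [mul_klFun_div hc]
  rw [integral_sub (hdiff.fun_add (integrable_const _)) hG, integral_add hdiff (integrable_const _),
    integral_sub hlog (hG.mul_const _), integral_mul_const, integral_const, probReal_univ,
    one_smul, entropy]
  ring

lemma entropy_le_integral_mul_klFun_div [IsProbabilityMeasure μ] (hG₀ : ∀ x, 0 ≤ G x)
    (hG : Integrable G μ) (hlog : Integrable (fun x ↦ G x * log (G x)) μ) {c : ℝ} (hc : 0 < c) :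
    entropy μ G ≤ ∫ x, c * klFun (G x / c) ∂μ := by
  rw [integral_mul_klFun_div hG hlog hc.ne']
  exact le_add_of_nonneg_right
    (mul_nonneg hc.le (klFun_nonneg (div_nonneg (integral_nonneg hG₀) hc.le)))

lemma mul_log_div {m : ℝ} (hm : m ≠ 0) (x : ℝ) :
    x * log (x / m) = x * log x - x * log m := by
  rcases eq_or_ne x 0 with rfl | hx
  · simp
  · rw [log_div hx hm, mul_sub]

lemma integrable_mul_log_div_integral (hG : Integrable G μ)
    (hlog : Integrable (fun x ↦ G x * log (G x)) μ) (hm : ∫ x, G x ∂μ ≠ 0) :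
    Integrable (fun x ↦ G x * log (G x / ∫ y, G y ∂μ)) μ := by
  simp only [mul_log_div hm]
  exact hlog.sub (hG.mul_const _)

lemma integral_mul_log_div_integral (hG : Integrable G μ)
    (hlog : Integrable (fun x ↦ G x * log (G x)) μ) (hm : ∫ x, G x ∂μ ≠ 0) :
    ∫ x, G x * log (G x / ∫ y, G y ∂μ) ∂μ = entropy μ G := by
  simp only [mul_log_div hm]
  rw [integral_sub hlog (hG.mul_const _), integral_mul_const, entropy]

/-- Since `t log t` is bounded below by `-1`, Fatou's lemma applies to it on a probability space. -/
lemma entropy_le_of_tendsto [IsProbabilityMeasure μ] {H : ℕ → Ω → ℝ} {D : ℕ → ℝ} {D₀ : ℝ}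
    (hH₀ : ∀ n x, 0 ≤ H n x) (hlog : ∀ n, Integrable (fun x ↦ H n x * log (H n x)) μ)
    (hlim : ∀ᵐ x ∂μ, Tendsto (H · x) atTop (𝓝 (G x)))
    (hmass : Tendsto (fun n ↦ ∫ x, H n x ∂μ) atTop (𝓝 (∫ x, G x ∂μ)))
    (hle : ∀ n, entropy μ (H n) ≤ D n) (hD : Tendsto D atTop (𝓝 D₀)) :
    Integrable (fun x ↦ G x * log (G x)) μ ∧ entropy μ G ≤ D₀ := by
  have hnonneg (n : ℕ) (x : Ω) : 0 ≤ H n x * log (H n x) + 1 := by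
    have := klFun_nonneg (hH₀ n x)
    rw [klFun_apply] at this
    linarith [hH₀ n x]
  have hbound (n : ℕ) : ∫ x, (H n x * log (H n x) + 1) ∂μ
      ≤ D n + (∫ x, H n x ∂μ) * log (∫ x, H n x ∂μ) + 1 := by
    have hleₙ := hle n
    rw [entropy] at hleₙ
    rw [integral_add (hlog n) (integrable_const 1), integral_const, probReal_univ, one_smul]
    linarith
  obtain ⟨hint, hfatou⟩ := integrable_and_integral_le_of_tendsto
    (fun n ↦ (hlog n).add (integrable_const 1)) hnonneg
    (hlim.mono fun x hx ↦ ((continuous_mul_log.tendsto _).comp hx).add_const 1) hbound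
    ((hD.add ((continuous_mul_log.tendsto _).comp hmass)).add_const 1)
  have hint' : Integrable (fun x ↦ G x * log (G x)) μ := integrable_add_const_iff.1 hint
  refine ⟨hint', ?_⟩
  rw [integral_add hint' (integrable_const 1), integral_const, probReal_univ, one_smul] at hfatou
  rw [entropy]
  linarith

end Entropy

section BoundedContinuous

variable {X Y G H : Type*} [TopologicalSpace X] [TopologicalSpace Y] [NormedAddCommGroup G]
  [NormedAddCommGroup H]

/-- Bounded continuous functions, as an unbundled predicate: the functions on which the heat
semigroup acts. -/
structure IsBoundedContinuous (F : X → G) : Prop where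
  continuous : Continuous F
  exists_norm_le : ∃ C, ∀ x, ‖F x‖ ≤ C

namespace IsBoundedContinuous

variable {F : X → G}

lemma comp_continuous (hF : IsBoundedContinuous F) {φ : Y → X} (hφ : Continuous φ) :
    IsBoundedContinuous fun y ↦ F (φ y) :=
  ⟨hF.continuous.comp hφ, hF.exists_norm_le.imp fun _ hC _ ↦ hC _⟩

lemma continuous_comp [ProperSpace G] (hF : IsBoundedContinuous F) {φ : G → H}
    (hφ : Continuous φ) : IsBoundedContinuous fun x ↦ φ (F x) := by
  obtain ⟨C, hC⟩ := hF.exists_norm_le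
  obtain ⟨D, hD⟩ := (isCompact_closedBall (0 : G) C).exists_bound_of_continuousOn hφ.continuousOn
  exact ⟨hφ.comp hF.continuous, D, fun x ↦ hD _ (by simpa using hC x)⟩

lemma mul_log {F : X → ℝ} (hF : IsBoundedContinuous F) :
    IsBoundedContinuous fun x ↦ F x * log (F x) :=
  hF.continuous_comp continuous_mul_log

lemma sub {F' : X → G} (hF : IsBoundedContinuous F) (hF' : IsBoundedContinuous F') :
    IsBoundedContinuous fun x ↦ F x - F' x := by
  obtain ⟨C, hC⟩ := hF.exists_norm_le
  obtain ⟨C', hC'⟩ := hF'.exists_norm_le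
  exact ⟨hF.continuous.sub hF'.continuous, C + C', fun x ↦ norm_sub_le_of_le (hC x) (hC' x)⟩

lemma integrable [MeasurableSpace X] [OpensMeasurableSpace X] [SecondCountableTopologyEither X G]
    {μ : Measure X} [IsFiniteMeasure μ] (hF : IsBoundedContinuous F) : Integrable F μ :=
  let ⟨C, hC⟩ := hF.exists_norm_le
  .of_bound hF.continuous.aestronglyMeasurable C (ae_of_all _ hC)

end IsBoundedContinuous

end BoundedContinuous

section Heat

variable {E : Type*} [NormedAddCommGroup E] [InnerProductSpace ℝ E] [FiniteDimensional ℝ E]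
  [MeasurableSpace E]
variable {G : Type*} [NormedAddCommGroup G]

/-- The heat semigroup at time `t ≥ 0`, which averages over a Gaussian of covariance `t`. -/
noncomputable def heat [NormedSpace ℝ G] (t : ℝ) (F : E → G) (x : E) : G :=
  ∫ y, F (x + √t • y) ∂(stdGaussian E)

lemma heat_one_zero [NormedSpace ℝ G] (F : E → G) : heat 1 F 0 = ∫ y, F y ∂(stdGaussian E) := by
  simp [heat]

variable [BorelSpace E]

lemma heat_zero [NormedSpace ℝ G] [CompleteSpace G] (F : E → G) : heat 0 F = F := by
  ext x
  simp [heat]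

lemma norm_heat_le [NormedSpace ℝ G] {F : E → G} {C : ℝ} (hC : ∀ x, ‖F x‖ ≤ C) (t : ℝ) (x : E) :
    ‖heat t F x‖ ≤ C := by
  simpa using! norm_integral_le_of_norm_le_const (μ := stdGaussian E)
    (ae_of_all _ fun y ↦ hC (x + √t • y))

namespace IsBoundedContinuous

variable {F : E → G}

lemma integrable_comp_add_smul (hF : IsBoundedContinuous F) (s : ℝ) (x : E) :
    Integrable (fun y ↦ F (x + s • y)) (stdGaussian E) :=
  have := FiniteDimensional.proper_real E
  (hF.comp_continuous (by fun_prop)).integrable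

variable [NormedSpace ℝ G]

lemma continuous_uncurry_heat (hF : IsBoundedContinuous F) :
    Continuous fun p : ℝ × E ↦ heat p.1 F p.2 := by
  obtain ⟨C, hC⟩ := hF.exists_norm_le
  have := hF.continuous
  exact continuous_of_dominated (bound := fun _ ↦ C)
    (fun p ↦ (hF.integrable_comp_add_smul _ _).aestronglyMeasurable)
    (fun _ ↦ ae_of_all _ fun _ ↦ hC _) (integrable_const _) (ae_of_all _ fun _ ↦ by fun_prop)

protected lemma heat (hF : IsBoundedContinuous F) (t : ℝ) : IsBoundedContinuous (heat t F) :=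
  ⟨hF.continuous_uncurry_heat.comp (by fun_prop : Continuous fun x ↦ (t, x)),
    hF.exists_norm_le.imp fun _ hC ↦ norm_heat_le hC t⟩

lemma heat_mono {F₁ F₂ : E → ℝ} (h₁ : IsBoundedContinuous F₁) (h₂ : IsBoundedContinuous F₂)
    (hle : ∀ x, F₁ x ≤ F₂ x) (t : ℝ) (x : E) : heat t F₁ x ≤ heat t F₂ x :=
  integral_mono (h₁.integrable_comp_add_smul _ x) (h₂.integrable_comp_add_smul _ x) fun _ ↦ hle _

end IsBoundedContinuous

variable [NormedSpace ℝ G]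

lemma map_smul_conv_map_smul_stdGaussian (r s : ℝ) :
    ((stdGaussian E).map (r • ·)) ∗ ((stdGaussian E).map (s • ·)) =
      (stdGaussian E).map (√(r ^ 2 + s ^ 2) • ·) := by
  have (r : ℝ) : IsProbabilityMeasure ((stdGaussian E).map (r • ·)) :=
    Measure.isProbabilityMeasure_map (by fun_prop)
  apply Measure.ext_of_charFun
  ext v
  rw [charFun_conv, charFun_map_smul, charFun_map_smul, charFun_map_smul]
  simp only [charFun_stdGaussian, norm_smul, ← Complex.exp_add]
  congr 1
  norm_cast
  simp only [mul_pow, norm_eq_abs, sq_abs]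
  rw [sq_sqrt (by positivity)]
  ring

lemma heat_eq_integral_map {F : E → G} (hF : IsBoundedContinuous F) (t : ℝ) (x : E) :
    heat t F x = ∫ z, F (x + z) ∂((stdGaussian E).map (√t • ·)) := by
  have := FiniteDimensional.proper_real E
  have := hF.continuous
  rw [heat, integral_map (by fun_prop) (Continuous.aestronglyMeasurable (by fun_prop))]

lemma heat_heat {F : E → G} (hF : IsBoundedContinuous F) {s t : ℝ} (hs : 0 ≤ s) (ht : 0 ≤ t) :
    heat t (heat s F) = heat (s + t) F := by
  ext x
  have := FiniteDimensional.proper_real E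
  have := hF.continuous
  have (r : ℝ) : IsProbabilityMeasure ((stdGaussian E).map (r • ·)) :=
    Measure.isProbabilityMeasure_map (by fun_prop)
  have hconv := map_smul_conv_map_smul_stdGaussian (E := E) (√t) (√s)
  rw [sq_sqrt ht, sq_sqrt hs, add_comm t s] at hconv
  rw [heat_eq_integral_map hF, ← hconv, integral_conv]
  · simp only [heat_eq_integral_map (hF.heat s), heat_eq_integral_map hF, add_assoc]
  · exact (hF.comp_continuous (continuous_const_add x)).integrable

end Heat

section RegularDensity

variable {E : Type*} [NormedAddCommGroup E] [InnerProductSpace ℝ E]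

/-- `F` is a bounded continuous function with values in `[a, ∞)`, whose gradient `V` is continuous
and bounded by `L`, the first order Taylor remainder being at most `K ‖y‖ ^ 2`. The constants are
recorded because they are preserved by the heat semigroup, which makes all estimates along the
heat flow uniform. -/
structure IsRegularDensity (a L K : ℝ) (F : E → ℝ) (V : E → E) : Prop where
  lower_pos : 0 < a
  lower_le : ∀ x, a ≤ F x
  isBoundedContinuous : IsBoundedContinuous F
  continuous_grad : Continuous V
  norm_grad_le : ∀ x, ‖V x‖ ≤ L
  taylor : ∀ x y, |F (x + y) - F x - ⟪V x, y⟫| ≤ K * ‖y‖ ^ 2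

/-- The density of the Fisher information of `F`, where `V` stands for the gradient of `F`. -/
noncomputable def fisherDensity (F : E → ℝ) (V : E → E) (x : E) : ℝ :=
  ‖V x‖ ^ 2 / F x

/-- The error, up to the factor `√t ^ 3`, in the expansion of the entropy of a regular density at
the point `√t • y`. With `B = L ‖y‖ + K ‖y‖ ^ 2`, it collects `B ^ 2 / a` from the Taylor
remainder of the density and `B ^ 3 / (2 a ^ 2)` from that of `klFun`. -/
noncomputable def entropyError (a L K : ℝ) (y : E) : ℝ :=
  (L * ‖y‖ + K * ‖y‖ ^ 2) ^ 2 / a + (L * ‖y‖ + K * ‖y‖ ^ 2) ^ 3 / (2 * a ^ 2)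

namespace IsRegularDensity

variable {a L K : ℝ} {F : E → ℝ} {V : E → E}

lemma pos (h : IsRegularDensity a L K F V) (x : E) : 0 < F x :=
  h.lower_pos.trans_le (h.lower_le x)

lemma isBoundedContinuous_grad (h : IsRegularDensity a L K F V) : IsBoundedContinuous V :=
  ⟨h.continuous_grad, L, h.norm_grad_le⟩

lemma isBoundedContinuous_fisherDensity (h : IsRegularDensity a L K F V) :
    IsBoundedContinuous (fisherDensity F V) := by
  refine ⟨(h.continuous_grad.norm.pow 2).div h.isBoundedContinuous.continuous
    fun x ↦ (h.pos x).ne', L ^ 2 / a, fun x ↦ ?_⟩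
  rw [fisherDensity, norm_of_nonneg (div_nonneg (sq_nonneg _) (h.pos x).le)]
  exact div_le_div₀ (sq_nonneg L) (by gcongr; exact h.norm_grad_le x) h.lower_pos (h.lower_le x)

lemma abs_sub_sub_le (h : IsRegularDensity a L K F V) {s : ℝ} (hs : 0 ≤ s) (x y : E) :
    |F (x + s • y) - F x - s * ⟪V x, y⟫| ≤ s ^ 2 * (K * ‖y‖ ^ 2) := by
  have := h.taylor x (s • y)
  rw [inner_smul_right, norm_smul, norm_of_nonneg hs] at this
  linarith

lemma abs_inner_grad_le (h : IsRegularDensity a L K F V) (x y : E) : |⟪V x, y⟫| ≤ L * ‖y‖ :=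
  (abs_real_inner_le_norm _ _).trans (by gcongr; exact h.norm_grad_le x)

lemma abs_sub_le (h : IsRegularDensity a L K F V) {s : ℝ} (hs : 0 ≤ s) (hs₁ : s ≤ 1) (x y : E) :
    |F (x + s • y) - F x| ≤ s * (L * ‖y‖ + K * ‖y‖ ^ 2) := by
  have hK : 0 ≤ K * ‖y‖ ^ 2 := (abs_nonneg _).trans (h.taylor x y)
  calc |F (x + s • y) - F x|
      ≤ |F (x + s • y) - F x - s * ⟪V x, y⟫| + |s * ⟪V x, y⟫| := by
        linarith [abs_sub_abs_le_abs_sub (F (x + s • y) - F x) (s * ⟪V x, y⟫)]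
    _ ≤ s * (K * ‖y‖ ^ 2) + s * (L * ‖y‖) := by
        rw [abs_mul, abs_of_nonneg hs]
        gcongr
        · refine (h.abs_sub_sub_le hs x y).trans ?_
          gcongr
          exact pow_le_of_le_one hs hs₁ two_ne_zero
        · exact h.abs_inner_grad_le x y
    _ = s * (L * ‖y‖ + K * ‖y‖ ^ 2) := by ring

lemma sq_sub_le (h : IsRegularDensity a L K F V) {s : ℝ} (hs : 0 ≤ s) (hs₁ : s ≤ 1) (x y : E) :
    (F (x + s • y) - F x) ^ 2
      ≤ s ^ 2 * ⟪V x, y⟫ ^ 2 + 2 * s ^ 3 * (L * ‖y‖ + K * ‖y‖ ^ 2) ^ 2 := by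
  set z := F (x + s • y) - F x
  set p := ⟪V x, y⟫
  set B := L * ‖y‖ + K * ‖y‖ ^ 2
  have hK : 0 ≤ K * ‖y‖ ^ 2 := (abs_nonneg _).trans (h.taylor x y)
  have hp : |p| ≤ L * ‖y‖ := h.abs_inner_grad_le x y
  have hLB : L * ‖y‖ ≤ B := le_add_of_nonneg_right hK
  have hKB : K * ‖y‖ ^ 2 ≤ B := le_add_of_nonneg_left ((abs_nonneg p).trans hp)
  have hB₀ : 0 ≤ B := hK.trans hKB
  have hdiff : |z - s * p| ≤ s ^ 2 * B :=
    (h.abs_sub_sub_le hs x y).trans (by gcongr)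
  have hsum : |z + s * p| ≤ 2 * s * B := calc
    |z + s * p| ≤ |z| + s * |p| := by
        simpa only [abs_mul, abs_of_nonneg hs] using abs_add_le z (s * p)
    _ ≤ s * B + s * B := by
        gcongr
        · exact h.abs_sub_le hs hs₁ x y
        · exact hp.trans hLB
    _ = 2 * s * B := by ring
  calc z ^ 2 = s ^ 2 * p ^ 2 + (z - s * p) * (z + s * p) := by ring
    _ ≤ s ^ 2 * p ^ 2 + |z - s * p| * |z + s * p| := by
        rw [← abs_mul]
        linarith [le_abs_self ((z - s * p) * (z + s * p))]
    _ ≤ s ^ 2 * p ^ 2 + s ^ 2 * B * (2 * s * B) := by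
        gcongr
    _ = s ^ 2 * p ^ 2 + 2 * s ^ 3 * B ^ 2 := by ring

lemma mul_klFun_div_le (h : IsRegularDensity a L K F V) {s : ℝ} (hs : 0 ≤ s) (hs₁ : s ≤ 1)
    (x y : E) :
    F x * klFun (F (x + s • y) / F x)
      ≤ s ^ 2 / (2 * F x) * ⟪V x, y⟫ ^ 2 + s ^ 3 * entropyError a L K y := by
  have ha := h.lower_pos
  have hx := h.pos x
  have hB : 0 ≤ L * ‖y‖ + K * ‖y‖ ^ 2 := by
    linarith [abs_nonneg ⟪V x, y⟫, h.abs_inner_grad_le x y, abs_nonneg _ |>.trans (h.taylor x y)]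
  calc F x * klFun (F (x + s • y) / F x)
      ≤ F x * ((F (x + s • y) / F x - 1) ^ 2 / 2 + |F (x + s • y) / F x - 1| ^ 3 / 2) := by
        gcongr
        exact klFun_le (div_nonneg (h.pos _).le hx.le)
    _ = (F (x + s • y) - F x) ^ 2 / (2 * F x) + |F (x + s • y) - F x| ^ 3 / (2 * F x ^ 2) := by
        rw [div_sub_one hx.ne', abs_div, abs_of_pos hx]
        field_simp
    _ ≤ (s ^ 2 * ⟪V x, y⟫ ^ 2 + 2 * s ^ 3 * (L * ‖y‖ + K * ‖y‖ ^ 2) ^ 2) / (2 * F x)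
          + (s * (L * ‖y‖ + K * ‖y‖ ^ 2)) ^ 3 / (2 * F x ^ 2) := by
        gcongr
        · exact h.sq_sub_le hs hs₁ x y
        · exact h.abs_sub_le hs hs₁ x y
    _ = s ^ 2 / (2 * F x) * ⟪V x, y⟫ ^ 2 + s ^ 3 * ((L * ‖y‖ + K * ‖y‖ ^ 2) ^ 2 / F x
          + (L * ‖y‖ + K * ‖y‖ ^ 2) ^ 3 / (2 * F x ^ 2)) := by
        field_simp
        ring
    _ ≤ s ^ 2 / (2 * F x) * ⟪V x, y⟫ ^ 2 + s ^ 3 * entropyError a L K y := by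
        rw [entropyError]
        gcongr <;> exact h.lower_le x

variable [FiniteDimensional ℝ E] [MeasurableSpace E] [BorelSpace E]

protected lemma heat (h : IsRegularDensity a L K F V) (t : ℝ) :
    IsRegularDensity a L K (heat t F) (heat t V) where
  lower_pos := h.lower_pos
  lower_le x := by
    simpa using! integral_mono (integrable_const a)
      (h.isBoundedContinuous.integrable_comp_add_smul (√t) x) fun y ↦ h.lower_le _
  isBoundedContinuous := h.isBoundedContinuous.heat t
  continuous_grad := (h.isBoundedContinuous_grad.heat t).continuous
  norm_grad_le := norm_heat_le h.norm_grad_le t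
  taylor x y := by
    have hF := h.isBoundedContinuous.integrable_comp_add_smul (√t) x
    have hFy := h.isBoundedContinuous.integrable_comp_add_smul (√t) (x + y)
    simp only [add_right_comm x y] at hFy
    have hV := h.isBoundedContinuous_grad.integrable_comp_add_smul (√t) x
    have hinner : ∫ z, ⟪V (x + √t • z), y⟫ ∂(stdGaussian E) = ⟪heat t V x, y⟫ := by
      simp only [real_inner_comm y]
      exact integral_inner hV y
    have hremainder : heat t F (x + y) - heat t F x - ⟪heat t V x, y⟫
        = ∫ z, (F (x + √t • z + y) - F (x + √t • z) - ⟪V (x + √t • z), y⟫) ∂(stdGaussian E) := by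
      rw [integral_sub (f := fun z ↦ F (x + √t • z + y) - F (x + √t • z)) (hFy.sub hF)
        (hV.inner_const y), integral_sub hFy hF, hinner]
      simp only [heat, add_right_comm x y]
    rw [hremainder, ← norm_eq_abs]
    simpa using! norm_integral_le_of_norm_le_const (μ := stdGaussian E)
      (ae_of_all _ fun z ↦ (norm_eq_abs _).trans_le (h.taylor (x + √t • z) y))

lemma fisherDensity_heat_le (h : IsRegularDensity a L K F V) (t : ℝ) (x : E) :
    fisherDensity (heat t F) (heat t V) x ≤ heat t (fisherDensity F V) x := by
  have hF := h.isBoundedContinuous.integrable_comp_add_smul (√t) x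
  have hV := h.isBoundedContinuous_grad.integrable_comp_add_smul (√t) x
  have hI := h.isBoundedContinuous_fisherDensity.integrable_comp_add_smul (√t) x
  have hsmul (z : E) : F z • (F z)⁻¹ • V z = V z := smul_inv_smul₀ (h.pos z).ne' _
  have hsq (z : E) : F z * ‖(F z)⁻¹ • V z‖ ^ 2 = fisherDensity F V z := by
    have := (h.pos z).ne'
    rw [norm_smul, norm_inv, mul_pow, norm_of_nonneg (h.pos z).le, fisherDensity]
    field_simp
  have := norm_integral_smul_sq_le (μ := stdGaussian E) (w := fun y ↦ F (x + √t • y))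
    (v := fun y ↦ (F (x + √t • y))⁻¹ • V (x + √t • y)) (fun _ ↦ (h.pos _).le) hF
    (by simpa only [hsmul] using hV) (by simpa only [hsq] using hI)
  simp only [hsmul, hsq] at this
  exact (div_le_iff₀' ((h.heat t).pos x)).2 this

end IsRegularDensity

end RegularDensity

section HeatEntropy

variable {E : Type*} [NormedAddCommGroup E] [InnerProductSpace ℝ E] [FiniteDimensional ℝ E]
  [MeasurableSpace E]

/-- The entropy of `F` for the heat kernel at time `t ≥ 0` issued from `x`. -/
noncomputable def heatEntropy (t : ℝ) (F : E → ℝ) (x : E) : ℝ :=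
  entropy (stdGaussian E) fun y ↦ F (x + √t • y)

lemma heatEntropy_eq (t : ℝ) (F : E → ℝ) (x : E) :
    heatEntropy t F x = heat t (fun z ↦ F z * log (F z)) x - heat t F x * log (heat t F x) :=
  rfl

lemma heatEntropy_one_zero (F : E → ℝ) : heatEntropy 1 F 0 = entropy (stdGaussian E) F := by
  simp [heatEntropy]

variable [BorelSpace E]

lemma IsBoundedContinuous.heatEntropy {F : E → ℝ} (hF : IsBoundedContinuous F) (t : ℝ) :
    IsBoundedContinuous (heatEntropy t F) :=
  (hF.mul_log.heat t).sub (hF.heat t).mul_log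

lemma heatEntropy_add {F : E → ℝ} (hF : IsBoundedContinuous F) {s t : ℝ} (hs : 0 ≤ s) (ht : 0 ≤ t)
    (x : E) :
    heatEntropy (s + t) F x = heat t (heatEntropy s F) x + heatEntropy t (heat s F) x := by
  have hsub : heat t (heatEntropy s F) x = heat t (heat s fun z ↦ F z * log (F z)) x
      - heat t (fun z ↦ heat s F z * log (heat s F z)) x :=
    integral_sub ((hF.mul_log.heat s).integrable_comp_add_smul _ _)
      ((hF.heat s).mul_log.integrable_comp_add_smul _ _)
  rw [hsub, heatEntropy_eq, heatEntropy_eq, heat_heat hF hs ht, heat_heat hF.mul_log hs ht]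
  ring

lemma integrable_norm_pow_stdGaussian (k : ℕ) :
    Integrable (fun y : E ↦ ‖y‖ ^ k) (stdGaussian E) := by
  simpa using (IsGaussian.memLp_id (stdGaussian E) k (by simp)).integrable_norm_pow'

lemma integrable_inner_sq_stdGaussian (v : E) :
    Integrable (fun y ↦ ⟪v, y⟫ ^ 2) (stdGaussian E) :=
  ((IsGaussian.memLp_id (stdGaussian E) 2 (by simp)).const_inner v).integrable_sq

lemma integral_inner_sq_stdGaussian (v : E) :
    ∫ y, ⟪v, y⟫ ^ 2 ∂(stdGaussian E) = ‖v‖ ^ 2 := by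
  have h := variance_dual_stdGaussian (innerSL ℝ v)
  rw [variance_of_integral_eq_zero (by fun_prop) (integral_strongDual_stdGaussian _)] at h
  simpa using! h

lemma integrable_entropyError (a L K : ℝ) :
    Integrable (entropyError a L K) (stdGaussian E) := by
  have hpow := integrable_norm_pow_stdGaussian (E := E)
  have hsq : Integrable (fun y : E ↦ (L * ‖y‖ + K * ‖y‖ ^ 2) ^ 2) (stdGaussian E) := by
    refine (((hpow 2).const_mul (L ^ 2)).add (((hpow 3).const_mul (2 * L * K)).add
      ((hpow 4).const_mul (K ^ 2)))).congr (ae_of_all _ fun y ↦ ?_)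
    simp only [Pi.add_apply]
    ring
  have hcube : Integrable (fun y : E ↦ (L * ‖y‖ + K * ‖y‖ ^ 2) ^ 3) (stdGaussian E) := by
    refine (((hpow 3).const_mul (L ^ 3)).add (((hpow 4).const_mul (3 * L ^ 2 * K)).add
      (((hpow 5).const_mul (3 * L * K ^ 2)).add ((hpow 6).const_mul (K ^ 3))))).congr
      (ae_of_all _ fun y ↦ ?_)
    simp only [Pi.add_apply]
    ring
  exact (hsq.div_const _).add (hcube.div_const _)

end HeatEntropy

section SmallTime

variable {E : Type*} [NormedAddCommGroup E] [InnerProductSpace ℝ E] [FiniteDimensional ℝ E]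
  [MeasurableSpace E] [BorelSpace E]
variable {a L K : ℝ} {F : E → ℝ} {V : E → E}

namespace IsRegularDensity

lemma heatEntropy_le (h : IsRegularDensity a L K F V) {t : ℝ} (ht : 0 ≤ t) (ht₁ : t ≤ 1) (x : E) :
    heatEntropy t F x
      ≤ t / 2 * fisherDensity F V x + √t ^ 3 * ∫ y, entropyError a L K y ∂(stdGaussian E) := by
  have hx := h.pos x
  have hF := h.isBoundedContinuous.integrable_comp_add_smul (√t) x
  have hlog := h.isBoundedContinuous.mul_log.integrable_comp_add_smul (√t) x
  have hkl := h.isBoundedContinuous.continuous_comp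
    (by fun_prop : Continuous fun r ↦ F x * klFun (r / F x)) |>.integrable_comp_add_smul (√t) x
  have hinner := (integrable_inner_sq_stdGaussian (V x)).const_mul (√t ^ 2 / (2 * F x))
  have herr := (integrable_entropyError (E := E) a L K).const_mul (√t ^ 3)
  calc heatEntropy t F x
      ≤ ∫ y, F x * klFun (F (x + √t • y) / F x) ∂(stdGaussian E) :=
        entropy_le_integral_mul_klFun_div (fun y ↦ (h.pos _).le) hF hlog hx
    _ ≤ ∫ y, (√t ^ 2 / (2 * F x) * ⟪V x, y⟫ ^ 2 + √t ^ 3 * entropyError a L K y)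
          ∂(stdGaussian E) :=
        integral_mono hkl (hinner.add herr) fun y ↦
          h.mul_klFun_div_le (sqrt_nonneg t) (sqrt_le_one.2 ht₁) x y
    _ = t / 2 * fisherDensity F V x + √t ^ 3 * ∫ y, entropyError a L K y ∂(stdGaussian E) := by
        rw [integral_add hinner herr, integral_const_mul, integral_const_mul,
          integral_inner_sq_stdGaussian, sq_sqrt ht, fisherDensity]
        ring

lemma heatEntropy_nat_mul_le (h : IsRegularDensity a L K F V) {t : ℝ} (ht : 0 ≤ t) (ht₁ : t ≤ 1)
    (m : ℕ) (x : E) :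
    heatEntropy ((m + 1) * t) F x
      ≤ (m + 1) * (t / 2 * heat (m * t) (fisherDensity F V) x
        + √t ^ 3 * ∫ y, entropyError a L K y ∂(stdGaussian E)) := by
  induction m generalizing F V x with
  | zero => simpa [heat_zero] using h.heatEntropy_le ht ht₁ x
  | succ m ih =>
    set δ := √t ^ 3 * ∫ y, entropyError a L K y ∂(stdGaussian E)
    have hmt : 0 ≤ (m : ℝ) * t := by positivity
    have hmt₁ : 0 ≤ ((m : ℝ) + 1) * t := by positivity
    have hfirst : heat ((m + 1) * t) (heatEntropy t F) x
        ≤ t / 2 * heat ((m + 1) * t) (fisherDensity F V) x + δ := by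
      have hI := (h.isBoundedContinuous_fisherDensity.integrable_comp_add_smul
        (√((m + 1) * t)) x).const_mul (t / 2)
      have := integral_mono ((h.isBoundedContinuous.heatEntropy t).integrable_comp_add_smul _ x)
        (hI.add (integrable_const δ)) fun y ↦ h.heatEntropy_le ht ht₁ (x + √((m + 1) * t) • y)
      rwa [integral_add' hI (integrable_const δ), integral_const_mul, integral_const,
        probReal_univ, one_smul] at this
    have hfisher : heat (m * t) (fisherDensity (heat t F) (heat t V)) x
        ≤ heat ((m + 1) * t) (fisherDensity F V) x := by
      refine (IsBoundedContinuous.heat_mono (h.heat t).isBoundedContinuous_fisherDensity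
        (h.isBoundedContinuous_fisherDensity.heat t) (h.fisherDensity_heat_le t) _ x).trans_eq ?_
      rw [heat_heat h.isBoundedContinuous_fisherDensity ht hmt,
        show t + m * t = (m + 1) * t by ring]
    push_cast
    calc heatEntropy ((m + 1 + 1) * t) F x
        = heatEntropy (t + (m + 1) * t) F x := by congr 1; ring
      _ = heat ((m + 1) * t) (heatEntropy t F) x + heatEntropy ((m + 1) * t) (heat t F) x :=
          heatEntropy_add h.isBoundedContinuous ht hmt₁ x
      _ ≤ (t / 2 * heat ((m + 1) * t) (fisherDensity F V) x + δ)
          + (m + 1) * (t / 2 * heat ((m + 1) * t) (fisherDensity F V) x + δ) :=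
          add_le_add hfirst ((ih (h.heat t) x).trans (by gcongr))
      _ = (m + 1 + 1) * (t / 2 * heat ((m + 1) * t) (fisherDensity F V) x + δ) := by ring

theorem entropy_le (h : IsRegularDensity a L K F V) :
    entropy (stdGaussian E) F ≤ 1 / 2 * ∫ x, fisherDensity F V x ∂(stdGaussian E) := by
  set M := ∫ y, entropyError a L K y ∂(stdGaussian E)
  set t : ℕ → ℝ := fun m ↦ 1 / ((m : ℝ) + 1)
  have ht₀ (m : ℕ) : 0 ≤ t m := by positivity
  have ht₁ (m : ℕ) : t m ≤ 1 := div_le_one_of_le₀ (by simp) (by positivity)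
  have htm (m : ℕ) : (m + 1) * t m = 1 := mul_one_div_cancel (by positivity)
  have htlim : Tendsto t atTop (𝓝 0) := tendsto_one_div_add_atTop_nhds_zero_nat
  have hstep (m : ℕ) : entropy (stdGaussian E) F
      ≤ 1 / 2 * heat (1 - t m) (fisherDensity F V) 0 + √(t m) * M := by
    have := h.heatEntropy_nat_mul_le (ht₀ m) (ht₁ m) m 0
    rw [htm, heatEntropy_one_zero] at this
    calc _ ≤ _ := this
      _ = (m + 1) * t m / 2 * heat (1 - t m) (fisherDensity F V) 0
          + (m + 1) * √(t m) ^ 2 * √(t m) * M := by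
        rw [show (m : ℝ) * t m = 1 - t m by linarith [htm m]]
        ring
      _ = _ := by rw [sq_sqrt (ht₀ m), htm, one_mul]
  have hheat : Tendsto (fun m ↦ heat (1 - t m) (fisherDensity F V) 0) atTop
      (𝓝 (∫ x, fisherDensity F V x ∂(stdGaussian E))) := by
    have hcont : Continuous fun r ↦ heat r (fisherDensity F V) 0 :=
      h.isBoundedContinuous_fisherDensity.continuous_uncurry_heat.comp
        (by fun_prop : Continuous fun r : ℝ ↦ (r, (0 : E)))
    rw [← heat_one_zero]
    exact (hcont.tendsto 1).comp (by simpa only [sub_zero] using htlim.const_sub 1)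
  have hlim : Tendsto (fun m ↦ 1 / 2 * heat (1 - t m) (fisherDensity F V) 0 + √(t m) * M) atTop
      (𝓝 (1 / 2 * ∫ x, fisherDensity F V x ∂(stdGaussian E))) := by
    simpa only [Function.comp_def, sqrt_zero, zero_mul, add_zero] using
      (hheat.const_mul (1 / 2)).add (((continuous_sqrt.tendsto 0).comp htlim).mul_const M)
  exact ge_of_tendsto' hlim hstep

end IsRegularDensity

end SmallTime

section CompactSupport

variable {E : Type*} [NormedAddCommGroup E] [InnerProductSpace ℝ E]

lemma abs_sub_sub_fderiv_le {h : E → ℝ} (hh : Differentiable ℝ h) {K : NNReal}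
    (hK : LipschitzWith K (fderiv ℝ h)) (x y : E) :
    |h (x + y) - h x - fderiv ℝ h x y| ≤ K * ‖y‖ ^ 2 := by
  have := (convex_closedBall x ‖y‖).norm_image_sub_le_of_norm_hasFDerivWithin_le'
    (f := h) (f' := fderiv ℝ h) (φ := fderiv ℝ h x) (C := K * ‖y‖)
    (fun z _ ↦ (hh z).hasFDerivAt.hasFDerivWithinAt)
    (fun z hz ↦ (hK.norm_sub_le z x).trans (by gcongr; simpa [dist_eq_norm] using hz))
    (x := x) (y := x + y) (by simp) (by simp)
  rwa [norm_eq_abs, add_sub_cancel_left, mul_assoc, ← sq] at this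

variable [FiniteDimensional ℝ E]

lemma norm_gradient (h : E → ℝ) (x : E) : ‖gradient h x‖ = ‖fderiv ℝ h x‖ := by
  rw [gradient, LinearIsometryEquiv.norm_map]

lemma continuous_gradient {h : E → ℝ} (hh : Continuous (fderiv ℝ h)) : Continuous (gradient h) :=
  (LinearIsometryEquiv.continuous _).comp hh

lemma hasCompactSupport_gradient {h : E → ℝ} (hs : HasCompactSupport h) :
    HasCompactSupport (gradient h) :=
  (hs.fderiv ℝ).comp_left (map_zero (InnerProductSpace.toDual ℝ E).symm)

lemma exists_isRegularDensity_add_const {h : E → ℝ} (hs : HasCompactSupport h)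
    (hc : ContDiff ℝ 2 h) (h₀ : ∀ x, 0 ≤ h x) {ε : ℝ} (hε : 0 < ε) :
    ∃ L K, IsRegularDensity ε L K (fun x ↦ h x + ε) (gradient h) := by
  have := FiniteDimensional.proper_real E
  have hc' : ContDiff ℝ 1 (fderiv ℝ h) := hc.fderiv_right (by norm_num)
  obtain ⟨b, hb⟩ := hs.exists_bound_of_continuous hc.continuous
  obtain ⟨L, hL⟩ := (hs.fderiv ℝ).exists_bound_of_continuous hc'.continuous
  obtain ⟨K, hK⟩ := hc'.lipschitzWith_of_hasCompactSupport (hs.fderiv ℝ) one_ne_zero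
  refine ⟨L, K, hε, fun x ↦ le_add_of_nonneg_left (h₀ x),
    IsBoundedContinuous.continuous_comp ⟨hc.continuous, b, hb⟩ (continuous_add_const ε),
    continuous_gradient hc'.continuous, fun x ↦ (norm_gradient h x).trans_le (hL x),
    fun x y ↦ ?_⟩
  rw [inner_gradient_left, add_sub_add_right_eq_sub]
  exact abs_sub_sub_fderiv_le (hc.differentiable (by norm_num)) hK x y

lemma fisherDensity_sq_add_le {f : E → ℝ} {x : E} (hf : DifferentiableAt ℝ f x) {ε : ℝ}
    (hε : 0 < ε) :
    fisherDensity (fun x ↦ f x ^ 2 + ε) (gradient fun x ↦ f x ^ 2) x ≤ 4 * ‖gradient f x‖ ^ 2 := by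
  have hgrad : ‖gradient (fun x ↦ f x ^ 2) x‖ ^ 2 = 4 * ‖gradient f x‖ ^ 2 * f x ^ 2 := by
    rw [norm_gradient, norm_gradient, fderiv_fun_pow 2 hf]
    simp only [norm_smul, mul_pow, norm_mul, norm_eq_abs, sq_abs, Nat.add_one_sub_one, pow_one,
      nsmul_eq_mul, Nat.cast_ofNat]
    ring
  rw [fisherDensity, hgrad, div_le_iff₀ (by positivity)]
  gcongr
  exact le_add_of_nonneg_right hε.le

variable [MeasurableSpace E] [BorelSpace E]

theorem entropy_sq_le_of_hasCompactSupport {f : E → ℝ} (hs : HasCompactSupport f)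
    (hf : ContDiff ℝ 2 f) :
    Integrable (fun x ↦ f x ^ 2 * log (f x ^ 2)) (stdGaussian E) ∧
      entropy (stdGaussian E) (fun x ↦ f x ^ 2)
        ≤ 2 * ∫ x, ‖gradient f x‖ ^ 2 ∂(stdGaussian E) := by
  have := FiniteDimensional.proper_real E
  have hs₂ : HasCompactSupport fun x ↦ f x ^ 2 := hs.comp_left (g := (· ^ 2)) (by simp)
  have hf₂ : ContDiff ℝ 2 fun x ↦ f x ^ 2 := hf.pow 2
  have hmass : Integrable (fun x ↦ f x ^ 2) (stdGaussian E) :=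
    hf₂.continuous.integrable_of_hasCompactSupport hs₂
  have hgs : HasCompactSupport fun x ↦ ‖gradient f x‖ ^ 2 :=
    (hasCompactSupport_gradient hs).comp_left (g := fun v : E ↦ ‖v‖ ^ 2) (by simp)
  have hgc : Continuous fun x ↦ ‖gradient f x‖ ^ 2 :=
    (continuous_gradient (hf.continuous_fderiv two_ne_zero)).norm.pow 2
  have hgrad : Integrable (fun x ↦ ‖gradient f x‖ ^ 2) (stdGaussian E) :=
    hgc.integrable_of_hasCompactSupport hgs
  set ε : ℕ → ℝ := fun n ↦ 1 / ((n : ℝ) + 1)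
  have hε (n : ℕ) : 0 < ε n := by positivity
  have hεlim : Tendsto ε atTop (𝓝 0) := tendsto_one_div_add_atTop_nhds_zero_nat
  choose L K hreg using fun n ↦
    exists_isRegularDensity_add_const hs₂ hf₂ (fun _ ↦ sq_nonneg _) (hε n)
  refine entropy_le_of_tendsto (H := fun n x ↦ f x ^ 2 + ε n)
    (D := fun _ ↦ 2 * ∫ x, ‖gradient f x‖ ^ 2 ∂(stdGaussian E)) (fun n x ↦ ((hreg n).pos x).le)
    (fun n ↦ (hreg n).isBoundedContinuous.mul_log.integrable)
    (ae_of_all _ fun x ↦ by simpa using hεlim.const_add (f x ^ 2)) ?_ (fun n ↦ ?_)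
    tendsto_const_nhds
  · simp only [integral_add hmass (integrable_const _), integral_const, probReal_univ, one_smul]
    simpa using hεlim.const_add (∫ x, f x ^ 2 ∂(stdGaussian E))
  · calc entropy (stdGaussian E) (fun x ↦ f x ^ 2 + ε n)
        ≤ 1 / 2 * ∫ x, fisherDensity (fun x ↦ f x ^ 2 + ε n) (gradient fun x ↦ f x ^ 2) x
            ∂(stdGaussian E) := (hreg n).entropy_le
      _ ≤ 1 / 2 * ∫ x, 4 * ‖gradient f x‖ ^ 2 ∂(stdGaussian E) := by
        refine mul_le_mul_of_nonneg_left (integral_mono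
          (hreg n).isBoundedContinuous_fisherDensity.integrable (hgrad.const_mul 4) fun x ↦ ?_)
          one_half_pos.le
        exact fisherDensity_sq_add_le (hf.differentiable two_ne_zero x) (hε n)
      _ = 2 * ∫ x, ‖gradient f x‖ ^ 2 ∂(stdGaussian E) := by
        rw [integral_const_mul]
        ring

end CompactSupport

section GaussianDensity

variable {E : Type*} [NormedAddCommGroup E] [InnerProductSpace ℝ E]

/-- The Lebesgue density `(2π)^(-dim E / 2) exp (-‖x‖² / 2)` of the standard Gaussian measure,
written in the shape of Mathlib's Gaussian integrals with parameter `b = 1 / 2`. -/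
noncomputable def stdGaussianPDFReal (x : E) : ℝ :=
  (π / (1 / 2)) ^ (-(Module.finrank ℝ E / 2 : ℝ)) * exp (-(1 / 2) * ‖x‖ ^ 2)

lemma stdGaussianPDFReal_pos (x : E) : 0 < stdGaussianPDFReal x := by
  unfold stdGaussianPDFReal
  positivity

lemma stdGaussianPDFReal_neg (x : E) : stdGaussianPDFReal (-x) = stdGaussianPDFReal x := by
  rw [stdGaussianPDFReal, norm_neg, stdGaussianPDFReal]

lemma continuous_stdGaussianPDFReal : Continuous (stdGaussianPDFReal : E → ℝ) := by
  unfold stdGaussianPDFReal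
  fun_prop

lemma norm_stdGaussianPDFReal_le (x : E) :
    ‖stdGaussianPDFReal x‖ ≤ (π / (1 / 2)) ^ (-(Module.finrank ℝ E / 2 : ℝ)) := by
  rw [norm_of_nonneg (stdGaussianPDFReal_pos x).le]
  exact mul_le_of_le_one_right (by positivity) (exp_le_one_iff.2 (by nlinarith [sq_nonneg ‖x‖]))

variable [FiniteDimensional ℝ E] [MeasurableSpace E] [BorelSpace E]

lemma integral_stdGaussianPDFReal : ∫ x : E, stdGaussianPDFReal x = 1 := by
  unfold stdGaussianPDFReal
  rw [integral_const_mul, GaussianFourier.integral_rexp_neg_mul_sq_norm (by norm_num),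
    ← rpow_add (by positivity), neg_add_cancel, rpow_zero]

lemma integrable_stdGaussianPDFReal : Integrable (stdGaussianPDFReal : E → ℝ) :=
  .of_integral_ne_zero (integral_stdGaussianPDFReal.trans_ne one_ne_zero)

lemma integral_stdGaussianPDFReal_mul_cexp (t : E) :
    ∫ x, (stdGaussianPDFReal x : ℂ) * Complex.exp (⟪x, t⟫ * Complex.I)
      = Complex.exp (-‖t‖ ^ 2 / 2) := by
  have hexp (x : E) : (stdGaussianPDFReal x : ℂ) * Complex.exp (⟪x, t⟫ * Complex.I)
      = (π / (1 / 2)) ^ (-(Module.finrank ℝ E / 2 : ℂ))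
        * Complex.exp (-(1 / 2) * ‖x‖ ^ 2 + Complex.I * ⟪t, x⟫) := by
    rw [stdGaussianPDFReal, Complex.exp_add, real_inner_comm, Complex.ofReal_mul,
      Complex.ofReal_cpow (by positivity)]
    push_cast
    ring_nf
  have hbase : (π / (1 / 2) : ℂ) ≠ 0 := by simp [pi_ne_zero]
  simp only [hexp]
  rw [integral_const_mul, GaussianFourier.integral_cexp_neg_mul_sq_norm_add (by norm_num),
    ← mul_assoc, ← Complex.cpow_add _ _ hbase, neg_add_cancel, Complex.cpow_zero, one_mul,
    Complex.I_sq]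
  congr 1
  ring

lemma stdGaussian_eq_withDensity :
    stdGaussian E = volume.withDensity fun x ↦ ENNReal.ofReal (stdGaussianPDFReal x) := by
  have : IsFiniteMeasure (volume.withDensity fun x : E ↦ ENNReal.ofReal (stdGaussianPDFReal x)) :=
    isFiniteMeasure_withDensity_ofReal integrable_stdGaussianPDFReal.2
  refine Measure.ext_of_charFun (funext fun t ↦ ?_)
  rw [charFun_stdGaussian, charFun_apply, integral_withDensity_eq_integral_toReal_smul
    (by exact continuous_stdGaussianPDFReal.measurable.ennreal_ofReal) (by simp),
    ← integral_stdGaussianPDFReal_mul_cexp t]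
  simp only [ENNReal.toReal_ofReal (stdGaussianPDFReal_pos _).le, Complex.real_smul]

lemma stdGaussian_absolutelyContinuous : stdGaussian E ≪ (volume : Measure E) := by
  rw [stdGaussian_eq_withDensity]
  exact withDensity_absolutelyContinuous _ _

lemma integrable_stdGaussian_iff {q : E → ℝ} :
    Integrable q (stdGaussian E) ↔ Integrable fun x ↦ stdGaussianPDFReal x * q x := by
  rw [stdGaussian_eq_withDensity, integrable_withDensity_iff_integrable_smul'
    (by exact continuous_stdGaussianPDFReal.measurable.ennreal_ofReal) (by simp)]
  simp only [ENNReal.toReal_ofReal (stdGaussianPDFReal_pos _).le, smul_eq_mul]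

lemma integral_stdGaussian_eq (q : E → ℝ) :
    ∫ x, q x ∂(stdGaussian E) = ∫ x, stdGaussianPDFReal x * q x := by
  rw [stdGaussian_eq_withDensity, integral_withDensity_eq_integral_toReal_smul
    (by exact continuous_stdGaussianPDFReal.measurable.ennreal_ofReal) (by simp)]
  simp only [ENNReal.toReal_ofReal (stdGaussianPDFReal_pos _).le, smul_eq_mul]

lemma integrable_stdGaussian_of_integrable {q : E → ℝ} (hq : Integrable q) :
    Integrable q (stdGaussian E) :=
  integrable_stdGaussian_iff.2 <| hq.bdd_mul continuous_stdGaussianPDFReal.aestronglyMeasurable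
    (ae_of_all _ norm_stdGaussianPDFReal_le)

lemma integrable_of_integrable_stdGaussian_of_hasCompactSupport {q : E → ℝ}
    (hq : Integrable q (stdGaussian E)) (hs : HasCompactSupport q) : Integrable q := by
  have hne (x : E) : stdGaussianPDFReal x ≠ 0 := (stdGaussianPDFReal_pos x).ne'
  have hmul := (integrable_stdGaussian_iff.1 hq).integrableOn (s := tsupport q) |>.continuousOn_mul
    (continuous_stdGaussianPDFReal.inv₀ hne).continuousOn hs
  refine (integrableOn_iff_integrable_of_support_subset (subset_tsupport q)).1 ?_
  simpa only [Pi.inv_apply, inv_mul_cancel_left₀ (hne _)] using hmul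

end GaussianDensity

section Mollification

open ContinuousLinearMap (lsmul)
open scoped Convolution

variable {E : Type*} [NormedAddCommGroup E]

variable (E) in
/-- A sequence of smooth bumps shrinking to the origin, used as convolution kernels. The outer
radius is a fixed multiple of the inner one, as Lebesgue differentiation requires. -/
noncomputable def mollifier (n : ℕ) : ContDiffBump (0 : E) where
  rIn := 1 / ((n : ℝ) + 1)
  rOut := 2 * (1 / ((n : ℝ) + 1))
  rIn_pos := by positivity
  rIn_lt_rOut := lt_mul_left (by positivity) one_lt_two

lemma tendsto_rOut_mollifier : Tendsto (fun n ↦ (mollifier E n).rOut) atTop (𝓝 0) := by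
  simpa only [mollifier, mul_zero] using
    (tendsto_one_div_add_atTop_nhds_zero_nat (𝕜 := ℝ)).const_mul 2

variable [InnerProductSpace ℝ E] [FiniteDimensional ℝ E] [MeasurableSpace E] [BorelSpace E]
variable {H : Type*} [NormedAddCommGroup H] [NormedSpace ℝ H]

/-- The regularisation of `v` by convolution with the normalised `n`-th mollifier. -/
noncomputable def mollify (n : ℕ) (v : E → H) : E → H :=
  (mollifier E n).normed volume ⋆[lsmul ℝ ℝ] v

lemma ae_tendsto_mollify [CompleteSpace H] {v : E → H} (hv : LocallyIntegrable v volume) :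
    ∀ᵐ x, Tendsto (mollify · v x) atTop (𝓝 (v x)) :=
  ContDiffBump.ae_convolution_tendsto_right_of_locallyIntegrable tendsto_rOut_mollifier
    (K := 2) (Eventually.of_forall fun _ ↦ le_rfl) hv

lemma convolutionExists_mollifier (n : ℕ) {v : E → H} (hv : LocallyIntegrable v volume) :
    ConvolutionExists ((mollifier E n).normed volume) v (lsmul ℝ ℝ) volume :=
  (mollifier E n).hasCompactSupport_normed.convolutionExists_left _
    (mollifier E n).continuous_normed hv

lemma continuous_mollify (n : ℕ) {v : E → H} (hv : LocallyIntegrable v volume) :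
    Continuous (mollify n v) :=
  (mollifier E n).hasCompactSupport_normed.continuous_convolution_left _
    (mollifier E n).continuous_normed hv

lemma norm_mollify_sq_le (n : ℕ) {v : E → H} (hv : LocallyIntegrable v volume)
    (hv₂ : LocallyIntegrable (fun x ↦ ‖v x‖ ^ 2) volume) (x : E) :
    ‖mollify n v x‖ ^ 2 ≤ mollify n (fun x ↦ ‖v x‖ ^ 2) x := by
  have := norm_integral_smul_sq_le (mollifier E n).nonneg_normed
    (mollifier E n).integrable_normed (convolutionExists_mollifier n hv x)
    (convolutionExists_mollifier n hv₂ x)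
  rwa [(mollifier E n).integral_normed, one_mul] at this

lemma integrable_mollify (n : ℕ) {v : E → H} (hv : Integrable v) : Integrable (mollify n v) :=
  (mollifier E n).integrable_normed.integrable_convolution _ hv

lemma integral_stdGaussian_eq_convolution (q : E → ℝ) :
    ∫ x, q x ∂(stdGaussian E) = (q ⋆[lsmul ℝ ℝ] stdGaussianPDFReal) 0 := by
  rw [integral_stdGaussian_eq, convolution_def]
  simp only [ContinuousLinearMap.lsmul_apply, zero_sub, stdGaussianPDFReal_neg, smul_eq_mul,
    mul_comm]

lemma continuous_convolution_stdGaussianPDFReal {q : E → ℝ} (hq : Integrable q) :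
    Continuous (q ⋆[lsmul ℝ ℝ] stdGaussianPDFReal) :=
  BddAbove.continuous_convolution_right_of_integrable _
    ⟨_, Set.forall_mem_range.2 norm_stdGaussianPDFReal_le⟩ hq continuous_stdGaussianPDFReal

/-- A Gaussian integral is a convolution with the Gaussian density evaluated at the origin, so the
mollifier moves from `q` to a continuous function by associativity of convolution. -/
lemma integral_mollify_stdGaussian (n : ℕ) {q : E → ℝ} (hq : Integrable q) :
    ∫ x, mollify n q x ∂(stdGaussian E)
      = ((mollifier E n).normed volume ⋆[lsmul ℝ ℝ] (q ⋆[lsmul ℝ ℝ] stdGaussianPDFReal)) 0 := by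
  have hφ := (mollifier E n).continuous_normed (μ := volume)
  have hw : Continuous (stdGaussianPDFReal : E → ℝ) := continuous_stdGaussianPDFReal
  have hbdd : BddAbove (Set.range fun x : E ↦ ‖‖stdGaussianPDFReal x‖‖) :=
    ⟨_, Set.forall_mem_range.2 fun x ↦ (norm_norm _).trans_le (norm_stdGaussianPDFReal_le x)⟩
  have hqw : Continuous ((fun x ↦ ‖q x‖) ⋆[ContinuousLinearMap.mul ℝ ℝ]
      fun x ↦ ‖stdGaussianPDFReal x‖) :=
    hbdd.continuous_convolution_right_of_integrable _ hq.norm hw.norm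
  rw [integral_stdGaussian_eq_convolution]
  exact convolution_assoc _ _ _ _ mul_assoc hφ.aestronglyMeasurable hq.aestronglyMeasurable
    hw.aestronglyMeasurable
    (ae_of_all _ (convolutionExists_mollifier n hq.locallyIntegrable))
    (ae_of_all _ fun x ↦ hq.norm.mul_bdd (hw.comp (continuous_sub_left x)).norm.aestronglyMeasurable
      (ae_of_all _ fun t ↦ (norm_norm _).trans_le (norm_stdGaussianPDFReal_le (x - t))))
    ((mollifier E n).hasCompactSupport_normed.norm.convolutionExists_left _ hφ.norm
      hqw.locallyIntegrable 0)

lemma tendsto_integral_mollify_stdGaussian {q : E → ℝ} (hq : Integrable q) :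
    Tendsto (fun n ↦ ∫ x, mollify n q x ∂(stdGaussian E)) atTop
      (𝓝 (∫ x, q x ∂(stdGaussian E))) := by
  simp only [integral_mollify_stdGaussian _ hq]
  rw [integral_stdGaussian_eq_convolution]
  exact ContDiffBump.convolution_tendsto_right_of_continuous tendsto_rOut_mollifier
    (continuous_convolution_stdGaussianPDFReal hq) 0

lemma tendsto_integral_norm_mollify_sq [CompleteSpace H] {v : E → H}
    (hv : LocallyIntegrable v volume) (hv₂ : Integrable fun x ↦ ‖v x‖ ^ 2) :
    Tendsto (fun n ↦ ∫ x, ‖mollify n v x‖ ^ 2 ∂(stdGaussian E)) atTop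
      (𝓝 (∫ x, ‖v x‖ ^ 2 ∂(stdGaussian E))) := by
  have hle (n : ℕ) (x : E) : ‖mollify n v x‖ ^ 2 ≤ mollify n (fun x ↦ ‖v x‖ ^ 2) x :=
    norm_mollify_sq_le n hv hv₂.locallyIntegrable x
  have hbound (n : ℕ) : Integrable (mollify n fun x ↦ ‖v x‖ ^ 2) (stdGaussian E) :=
    integrable_stdGaussian_of_integrable (integrable_mollify n hv₂)
  have hint (n : ℕ) : Integrable (fun x ↦ ‖mollify n v x‖ ^ 2) (stdGaussian E) :=
    (hbound n).mono' ((continuous_mollify n hv).norm.pow 2).aestronglyMeasurable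
      (ae_of_all _ fun x ↦ (norm_of_nonneg (sq_nonneg _)).trans_le (hle n x))
  have hlim : ∀ᵐ x ∂(stdGaussian E), Tendsto (mollify · v x) atTop (𝓝 (v x)) :=
    stdGaussian_absolutelyContinuous.ae_le (ae_tendsto_mollify hv)
  exact tendsto_integral_of_le_of_tendsto hint (fun n x ↦ sq_nonneg _)
    (hlim.mono fun x hx ↦ hx.norm.pow 2)
    (fun n ↦ integral_mono (hint n) (hbound n) (hle n)) (tendsto_integral_mollify_stdGaussian hv₂)

end Mollification

section Cutoff

variable {E : Type*} [NormedAddCommGroup E] [InnerProductSpace ℝ E] [FiniteDimensional ℝ E]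

variable (E) in
/-- A smooth compactly supported function with values in `[0, 1]`, equal to one on the ball of
radius `n + 1`, used to truncate functions at infinity. -/
noncomputable def cutoff (n : ℕ) (x : E) : ℝ :=
  (⟨1, 2, one_pos, one_lt_two⟩ : ContDiffBump (0 : E)) ((1 / ((n : ℝ) + 1)) • x)

lemma contDiff_cutoff (n : ℕ) : ContDiff ℝ ∞ (cutoff E n) :=
  (ContDiffBump.contDiff _).comp (contDiff_const_smul _)

lemma hasCompactSupport_cutoff (n : ℕ) : HasCompactSupport (cutoff E n) :=
  (ContDiffBump.hasCompactSupport _).comp_homeomorph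
    (Homeomorph.smulOfNeZero (1 / ((n : ℝ) + 1)) (by positivity))

lemma continuous_gradient_cutoff (n : ℕ) : Continuous (gradient (cutoff E n)) :=
  continuous_gradient ((contDiff_cutoff n).continuous_fderiv (by simp))

lemma norm_cutoff_le_one (n : ℕ) (x : E) : ‖cutoff E n x‖ ≤ 1 := by
  rw [cutoff, norm_of_nonneg (ContDiffBump.nonneg _)]
  exact ContDiffBump.le_one _

lemma tendsto_cutoff (x : E) : Tendsto (cutoff E · x) atTop (𝓝 1) := by
  set φ : ContDiffBump (0 : E) := ⟨1, 2, one_pos, one_lt_two⟩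
  have hscale : Tendsto (fun n : ℕ ↦ (1 / ((n : ℝ) + 1)) • x) atTop (𝓝 0) := by
    simpa only [zero_smul] using (tendsto_one_div_add_atTop_nhds_zero_nat (𝕜 := ℝ)).smul_const x
  have hφ : φ 0 = 1 := φ.one_of_mem_closedBall (Metric.mem_closedBall_self φ.rIn_pos.le)
  rw [← hφ]
  exact (φ.continuous.tendsto _).comp hscale

lemma exists_norm_gradient_cutoff_le :
    ∃ M, ∀ n (x : E), ‖gradient (cutoff E n) x‖ ≤ 1 / ((n : ℝ) + 1) * M := by
  set φ : ContDiffBump (0 : E) := ⟨1, 2, one_pos, one_lt_two⟩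
  obtain ⟨M, hM⟩ := (φ.hasCompactSupport.fderiv ℝ).exists_bound_of_continuous
    (φ.contDiff (n := 1).continuous_fderiv one_ne_zero)
  refine ⟨M, fun n x ↦ ?_⟩
  have hscale : fderiv ℝ (cutoff E n) x
      = (1 / ((n : ℝ) + 1)) • fderiv ℝ φ ((1 / ((n : ℝ) + 1)) • x) :=
    fderiv_comp_smul (f := φ) _
  rw [norm_gradient, hscale, norm_smul, norm_of_nonneg (by positivity)]
  gcongr
  exact hM _

lemma tendsto_gradient_cutoff (x : E) :
    Tendsto (fun n ↦ gradient (cutoff E n) x) atTop (𝓝 0) := by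
  obtain ⟨M, hM⟩ := exists_norm_gradient_cutoff_le (E := E)
  refine squeeze_zero_norm (fun n ↦ hM n x) ?_
  simpa only [zero_mul] using (tendsto_one_div_add_atTop_nhds_zero_nat (𝕜 := ℝ)).mul_const M

lemma exists_forall_norm_gradient_cutoff_le : ∃ M, ∀ n (x : E), ‖gradient (cutoff E n) x‖ ≤ M := by
  obtain ⟨M, hM⟩ := exists_norm_gradient_cutoff_le (E := E)
  have hM₀ : 0 ≤ M := by simpa using (norm_nonneg _).trans (hM 0 0)
  refine ⟨M, fun n x ↦ (hM n x).trans (mul_le_of_le_one_left hM₀ ?_)⟩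
  exact div_le_one_of_le₀ (by simp) (by positivity)

/-- The truncation `χₙ f` of `f`, where `χₙ` is the `n`-th cutoff. -/
noncomputable def truncate (n : ℕ) (f : E → ℝ) (x : E) : ℝ :=
  cutoff E n x * f x

/-- The gradient `χₙ g + f ∇χₙ` of the truncation `χₙ f`, where `g` stands for the gradient of
`f`. -/
noncomputable def truncateGradient (n : ℕ) (f : E → ℝ) (g : E → E) (x : E) : E :=
  cutoff E n x • g x + f x • gradient (cutoff E n) x

variable {f : E → ℝ} {g : E → E}

lemma hasCompactSupport_truncate (n : ℕ) : HasCompactSupport (truncate n f) :=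
  (hasCompactSupport_cutoff n).mul_right

lemma hasCompactSupport_truncateGradient (n : ℕ) : HasCompactSupport (truncateGradient n f g) :=
  HasCompactSupport.add (hasCompactSupport_cutoff n).smul_right
    (hasCompactSupport_gradient (hasCompactSupport_cutoff n)).smul_left

lemma norm_truncate_le (n : ℕ) (x : E) : ‖truncate n f x‖ ≤ ‖f x‖ := by
  rw [truncate, norm_mul]
  exact mul_le_of_le_one_left (norm_nonneg _) (norm_cutoff_le_one n x)

lemma exists_norm_truncateGradient_le :
    ∃ M, ∀ n (f : E → ℝ) (g : E → E) x, ‖truncateGradient n f g x‖ ≤ ‖g x‖ + ‖f x‖ * M := by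
  obtain ⟨M, hM⟩ := exists_forall_norm_gradient_cutoff_le (E := E)
  refine ⟨M, fun n f g x ↦ (norm_add_le _ _).trans (add_le_add ?_ ?_)⟩ <;> rw [norm_smul]
  · exact mul_le_of_le_one_left (norm_nonneg _) (norm_cutoff_le_one n x)
  · exact mul_le_mul_of_nonneg_left (hM n x) (norm_nonneg _)

lemma tendsto_truncate (x : E) : Tendsto (truncate · f x) atTop (𝓝 (f x)) := by
  simpa only [truncate, one_mul] using (tendsto_cutoff x).mul_const (f x)

lemma tendsto_truncateGradient (x : E) :
    Tendsto (truncateGradient · f g x) atTop (𝓝 (g x)) := by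
  simpa only [truncateGradient, one_smul, smul_zero, add_zero] using
    ((tendsto_cutoff x).smul_const (g x)).add ((tendsto_gradient_cutoff x).const_smul (f x))

variable [MeasurableSpace E] [BorelSpace E] {μ : Measure E}

lemma memLp_truncate (n : ℕ) (hf : MemLp f 2 μ) : MemLp (truncate n f) 2 μ :=
  hf.of_le ((contDiff_cutoff n).continuous.aestronglyMeasurable.mul hf.1)
    (ae_of_all _ (norm_truncate_le n))

lemma aestronglyMeasurable_truncateGradient (n : ℕ) (hf : AEStronglyMeasurable f μ)
    (hg : AEStronglyMeasurable g μ) : AEStronglyMeasurable (truncateGradient n f g) μ :=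
  ((contDiff_cutoff n).continuous.aestronglyMeasurable.smul hg).add
    (hf.smul (continuous_gradient_cutoff n).aestronglyMeasurable)

lemma memLp_truncateGradient (n : ℕ) (hf : MemLp f 2 μ) (hg : MemLp g 2 μ) :
    MemLp (truncateGradient n f g) 2 μ := by
  obtain ⟨M, hM⟩ := exists_norm_truncateGradient_le (E := E)
  exact (hg.norm.add (hf.norm.mul_const M)).mono'
    (aestronglyMeasurable_truncateGradient n hf.1 hg.1) (ae_of_all _ (hM n f g))

lemma tendsto_integral_truncate_sq (hf : MemLp f 2 μ) :
    Tendsto (fun n ↦ ∫ x, truncate n f x ^ 2 ∂μ) atTop (𝓝 (∫ x, f x ^ 2 ∂μ)) := by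
  simpa only [norm_eq_abs, sq_abs] using tendsto_integral_norm_sq_of_dominated
    (fun n ↦ (memLp_truncate n hf).1) hf.norm (fun n ↦ ae_of_all _ (norm_truncate_le n))
    (ae_of_all _ tendsto_truncate)

lemma tendsto_integral_norm_truncateGradient_sq (hf : MemLp f 2 μ) (hg : MemLp g 2 μ) :
    Tendsto (fun n ↦ ∫ x, ‖truncateGradient n f g x‖ ^ 2 ∂μ) atTop
      (𝓝 (∫ x, ‖g x‖ ^ 2 ∂μ)) := by
  obtain ⟨M, hM⟩ := exists_norm_truncateGradient_le (E := E)
  exact tendsto_integral_norm_sq_of_dominated (fun n ↦ (memLp_truncateGradient n hf hg).1)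
    (hg.norm.add (hf.norm.mul_const M)) (fun n ↦ ae_of_all _ (hM n f g))
    (ae_of_all _ tendsto_truncateGradient)

lemma integrable_norm_sq_of_memLp_stdGaussian {G : Type*} [NormedAddCommGroup G] {u : E → G}
    (hu : MemLp u 2 (stdGaussian E)) (hs : HasCompactSupport u) :
    Integrable fun x ↦ ‖u x‖ ^ 2 :=
  integrable_of_integrable_stdGaussian_of_hasCompactSupport hu.norm.integrable_sq
    (hs.comp_left (g := fun y : G ↦ ‖y‖ ^ 2) (by simp))

end Cutoff

section WeakGradient

variable {d : ℕ} {f : EuclideanSpace ℝ (Fin d) → ℝ}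
  {g : EuclideanSpace ℝ (Fin d) → EuclideanSpace ℝ (Fin d)}

lemma fderiv_mollify_apply (n : ℕ) (hf : LocallyIntegrable f volume)
    (x v : EuclideanSpace ℝ (Fin d)) :
    fderiv ℝ (mollify n f) x v
      = ∫ t, f t * fderiv ℝ ((mollifier _ n).normed volume) (x - t) v := by
  have hφ : HasCompactSupport ((mollifier (EuclideanSpace ℝ (Fin d)) n).normed volume) :=
    (mollifier _ n).hasCompactSupport_normed
  have hφ₁ : ContDiff ℝ 1 ((mollifier (EuclideanSpace ℝ (Fin d)) n).normed volume) :=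
    (mollifier _ n).contDiff_normed
  have hderiv := (hφ.hasFDerivAt_convolution_left (ContinuousLinearMap.lsmul ℝ ℝ) hφ₁ hf x).fderiv
  have hint := (hφ.fderiv ℝ).convolutionExists_left
    ((ContinuousLinearMap.lsmul ℝ ℝ).precompL (EuclideanSpace ℝ (Fin d)))
    (hφ₁.continuous_fderiv one_ne_zero) hf x
  rw [mollify, hderiv, convolution, ContinuousLinearMap.integral_apply hint,
    ← integral_sub_left_eq_self _ _ x]
  simp only [sub_sub_cancel, ContinuousLinearMap.precompL_apply, ContinuousLinearMap.lsmul_apply,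
    smul_eq_mul, mul_comm]

lemma inner_mollify (n : ℕ) (hg : LocallyIntegrable g volume) (x v : EuclideanSpace ℝ (Fin d)) :
    ⟪mollify n g x, v⟫ = ∫ t, (mollifier _ n).normed volume (x - t) * ⟪g t, v⟫ := by
  rw [mollify, real_inner_comm, convolution, ← integral_inner (convolutionExists_mollifier n hg x),
    ← integral_sub_left_eq_self _ _ x]
  simp only [sub_sub_cancel, ContinuousLinearMap.lsmul_apply, real_inner_smul_right,
    real_inner_comm]

lemma fderiv_comp_const_sub {E : Type*} [NormedAddCommGroup E] [NormedSpace ℝ E] {φ : E → ℝ}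
    (hφ : Differentiable ℝ φ) (x t : E) :
    fderiv ℝ (fun t ↦ φ (x - t)) t = -fderiv ℝ φ (x - t) := by
  have := (hφ (x - t)).hasFDerivAt.comp t ((hasFDerivAt_id t).const_sub x)
  exact this.fderiv.trans (by simp)

namespace HasWeakGradient

lemma gradient_mollify (h : HasWeakGradient f g) (n : ℕ) (x : EuclideanSpace ℝ (Fin d)) :
    gradient (mollify n f) x = mollify n g x := by
  obtain ⟨hf, hg, hfg⟩ := h
  set φ := (mollifier (EuclideanSpace ℝ (Fin d)) n).normed volume
  have hφ : ContDiff ℝ ∞ φ := (mollifier _ n).contDiff_normed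
  refine ext_inner_right ℝ fun v ↦ ?_
  have hparts := hfg (fun t ↦ φ (x - t)) (hφ.comp (contDiff_const.sub contDiff_id))
    ((mollifier _ n).hasCompactSupport_normed.comp_homeomorph (Homeomorph.subLeft x)) v
  simp only [fderiv_comp_const_sub (hφ.differentiable (by simp)), neg_apply,
    mul_neg, integral_neg, neg_inj] at hparts
  rw [inner_gradient_left, fderiv_mollify_apply n hf, inner_mollify n hg, hparts]

theorem entropy_sq_le_of_hasCompactSupport (h : HasWeakGradient f g) (hs : HasCompactSupport f)
    (hf : Integrable fun x ↦ f x ^ 2) (hg : Integrable fun x ↦ ‖g x‖ ^ 2) :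
    Integrable (fun x ↦ f x ^ 2 * log (f x ^ 2)) (stdGaussian _) ∧
      entropy (stdGaussian _) (fun x ↦ f x ^ 2) ≤ 2 * ∫ x, ‖g x‖ ^ 2 ∂(stdGaussian _) := by
  have hs' (n : ℕ) : HasCompactSupport (mollify n f) :=
    (mollifier _ n).hasCompactSupport_normed.convolution _ hs
  have hc (n : ℕ) : ContDiff ℝ 2 (mollify n f) :=
    (mollifier _ n).hasCompactSupport_normed.contDiff_convolution_left (n := 2) _
      (mollifier _ n).contDiff_normed h.1
  have hlsi (n : ℕ) := _root_.entropy_sq_le_of_hasCompactSupport (hs' n) (hc n)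
  simp only [h.gradient_mollify] at hlsi
  have hlim : ∀ᵐ x ∂(stdGaussian _), Tendsto (mollify · f x) atTop (𝓝 (f x)) :=
    stdGaussian_absolutelyContinuous.ae_le (ae_tendsto_mollify h.1)
  have hmass := tendsto_integral_norm_mollify_sq h.1 (by simpa only [norm_eq_abs, sq_abs] using hf)
  simp only [norm_eq_abs, sq_abs] at hmass
  exact entropy_le_of_tendsto (fun n x ↦ sq_nonneg _) (fun n ↦ (hlsi n).1)
    (hlim.mono fun x hx ↦ hx.pow 2) hmass (fun n ↦ (hlsi n).2)
    ((tendsto_integral_norm_mollify_sq h.2.1 hg).const_mul 2)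

lemma mul_contDiff (h : HasWeakGradient f g) {χ : EuclideanSpace ℝ (Fin d) → ℝ}
    (hχ : ContDiff ℝ ∞ χ) (hs : HasCompactSupport χ) :
    HasWeakGradient (fun x ↦ χ x * f x) (fun x ↦ χ x • g x + f x • gradient χ x) := by
  obtain ⟨hf, hg, hfg⟩ := h
  have hχ₁ : Continuous (fderiv ℝ χ) := hχ.continuous_fderiv (by simp)
  refine ⟨(hf.integrable_smul_left_of_hasCompactSupport hχ.continuous hs).locallyIntegrable,
    ((hg.integrable_smul_left_of_hasCompactSupport hχ.continuous hs).add
      (hf.integrable_smul_right_of_hasCompactSupport (continuous_gradient hχ₁)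
        (hasCompactSupport_gradient hs))).locallyIntegrable, fun φ hφ hφs v ↦ ?_⟩
  have hφ₁ : Continuous (fderiv ℝ φ) := hφ.continuous_fderiv (by simp)
  have hleibniz (x) :
      fderiv ℝ (fun x ↦ χ x * φ x) x v = χ x * fderiv ℝ φ x v + φ x * fderiv ℝ χ x v := by
    rw [fderiv_fun_mul (hχ.differentiable (by simp) x) (hφ.differentiable (by simp) x)]
    rfl
  have hint₁ : Integrable fun x ↦ f x * (χ x * fderiv ℝ φ x v) :=
    hf.integrable_smul_right_of_hasCompactSupport (by fun_prop) hs.mul_right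
  have hint₂ : Integrable fun x ↦ f x * (φ x * fderiv ℝ χ x v) :=
    hf.integrable_smul_right_of_hasCompactSupport (by fun_prop) hφs.mul_right
  have hint₃ : Integrable fun x ↦ χ x * φ x * ⟪g x, v⟫ := by
    simpa only [real_inner_smul_left] using! (hg.integrable_smul_left_of_hasCompactSupport
      (hχ.continuous.mul hφ.continuous) (hs.mul_right (f' := φ))).inner_const (𝕜 := ℝ) v
  have hparts := hfg (fun x ↦ χ x * φ x) (hχ.mul hφ) hs.mul_right v
  simp only [hleibniz, mul_add] at hparts
  rw [integral_add hint₁ hint₂] at hparts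
  have hinner (x) : φ x * ⟪χ x • g x + f x • gradient χ x, v⟫
      = χ x * φ x * ⟪g x, v⟫ + f x * (φ x * fderiv ℝ χ x v) := by
    rw [inner_add_left, real_inner_smul_left, real_inner_smul_left, inner_gradient_left]
    ring
  have hassoc (x) : χ x * f x * fderiv ℝ φ x v = f x * (χ x * fderiv ℝ φ x v) := by ring
  simp only [hinner, hassoc]
  rw [integral_add hint₃ hint₂]
  linarith

theorem entropy_sq_le (h : HasWeakGradient f g) (hf : MemLp f 2 (stdGaussian _))
    (hg : MemLp g 2 (stdGaussian _)) :
    Integrable (fun x ↦ f x ^ 2 * log (f x ^ 2)) (stdGaussian _) ∧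
      entropy (stdGaussian _) (fun x ↦ f x ^ 2) ≤ 2 * ∫ x, ‖g x‖ ^ 2 ∂(stdGaussian _) := by
  have htruncate (n : ℕ) : HasWeakGradient (truncate n f) (truncateGradient n f g) :=
    h.mul_contDiff (contDiff_cutoff n) (hasCompactSupport_cutoff n)
  have hf₂ (n : ℕ) : Integrable fun x ↦ truncate n f x ^ 2 := by
    simpa only [norm_eq_abs, sq_abs] using
      integrable_norm_sq_of_memLp_stdGaussian (memLp_truncate n hf) (hasCompactSupport_truncate n)
  have hg₂ (n : ℕ) : Integrable fun x ↦ ‖truncateGradient n f g x‖ ^ 2 :=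
    integrable_norm_sq_of_memLp_stdGaussian (memLp_truncateGradient n hf hg)
      (hasCompactSupport_truncateGradient n)
  have hlsi (n : ℕ) := (htruncate n).entropy_sq_le_of_hasCompactSupport
    (hasCompactSupport_truncate n) (hf₂ n) (hg₂ n)
  exact entropy_le_of_tendsto (fun n x ↦ sq_nonneg _) (fun n ↦ (hlsi n).1)
    (ae_of_all _ fun x ↦ (tendsto_truncate x).pow 2) (tendsto_integral_truncate_sq hf)
    (fun n ↦ (hlsi n).2) ((tendsto_integral_norm_truncateGradient_sq hf hg).const_mul 2)

end HasWeakGradient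

end WeakGradient

theorem mainTheorem3 :
    ∃ C : ℝ, 0 < C ∧
      ∀ (d : ℕ) (f : EuclideanSpace ℝ (Fin d) → ℝ)
        (g : EuclideanSpace ℝ (Fin d) → EuclideanSpace ℝ (Fin d)),
        MemLp f 2 (stdGaussian (EuclideanSpace ℝ (Fin d))) →
        MemLp g 2 (stdGaussian (EuclideanSpace ℝ (Fin d))) →
        HasWeakGradient f g →
          Integrable (fun x => f x ^ 2 *
              Real.log (f x ^ 2 / ∫ y, f y ^ 2 ∂(stdGaussian (EuclideanSpace ℝ (Fin d)))))
            (stdGaussian (EuclideanSpace ℝ (Fin d))) ∧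
          ∫ x, f x ^ 2 *
              Real.log (f x ^ 2 / ∫ y, f y ^ 2 ∂(stdGaussian (EuclideanSpace ℝ (Fin d))))
              ∂(stdGaussian (EuclideanSpace ℝ (Fin d))) ≤
            C * ∫ x, ‖g x‖ ^ 2 ∂(stdGaussian (EuclideanSpace ℝ (Fin d))) := by
  refine ⟨2, two_pos, fun d f g hf hg h ↦ ?_⟩
  obtain ⟨hlog, hle⟩ := h.entropy_sq_le hf hg
  by_cases hzero : ∫ y, f y ^ 2 ∂(stdGaussian (EuclideanSpace ℝ (Fin d))) = 0
  · simp only [hzero, div_zero, log_zero, mul_zero, integral_zero]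
    exact ⟨integrable_zero _ _ _, by positivity⟩
  · exact ⟨integrable_mul_log_div_integral hf.integrable_sq hlog hzero,
      (integral_mul_log_div_integral hf.integrable_sq hlog hzero).trans_le hle⟩
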